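/- Let $\Bbbk$ be a field, and let $n \geqslant 1$ and $d \geqslant 2$ be integers. Let $NC_A(n,d)$ be the associative unital $\Bbbk$-algebra generated by $T_1, \dots, T_n$ subject to the relations \[ T_i T_{i+1} T_i = T_{i+1} T_i T_{i+1} \ (0 < i < n), \qquad T_i T_j = T_j T_i \ (|i-j| > 1), \qquad T_1^2 = \cdots = T_{n-1}^2 = T_n^d = 0, \] that is, the generalized nil-Coxeter algebra of type $A_n$ with order vector $(2, \dots, 2, d)$. Then $NC_A(n,d)$ is a Frobenius algebra (i.e. it is finite-dimensional over $\Bbbk$ and admits a nondegenerate bilinear form $\sigma$ with $\sigma(xy,z) = \sigma(x,yz)$ for all $x,y,z$) if and only if $n = 1$ or $d = 2$. -/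

import Mathlib

/-- A generalized Coxeter matrix over the (finite) index set `I`: a symmetric matrix with entries
in `ℕ ∪ {∞}` whose off-diagonal entries are at least `2` and whose diagonal entries are finite. -/
structure GenCoxeterMatrix (I : Type*) [Finite I] where
  /-- The entries `m_{ij}`. -/
  entry : I → I → ℕ∞
  symm : ∀ i j, entry i j = entry j i
  two_le : ∀ i j, i ≠ j → 2 ≤ entry i j
  diag_ne_top : ∀ i, entry i i ≠ ⊤

/-- `M(d)`: the matrix obtained from `M` on replacing its diagonal by the integer vector `d`. -/
def GenCoxeterMatrix.withDiag {I : Type*} [Finite I] [DecidableEq I]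
    (M : GenCoxeterMatrix I) (d : I → ℕ) : GenCoxeterMatrix I where
  entry i j := if i = j then (d i : ℕ∞) else M.entry i j
  symm i j := by
    by_cases h : i = j
    · subst h; rfl
    · rw [if_neg h, if_neg (Ne.symm h), M.symm]
  two_le i j h := by
    rw [if_neg h]; exact M.two_le i j h
  diag_ne_top i := by
    rw [if_pos rfl]; exact ENat.natCast_ne_top _

/-- The Coxeter matrix of type `A_n`, with diagonal entries `2`; the nodes `1, …, n` of the
diagram are represented by `0, …, n - 1` in `Fin n`. -/
def GenCoxeterMatrix.typeA (n : ℕ) : GenCoxeterMatrix (Fin n) where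
  entry i j := if (i : ℕ) + 1 = j ∨ (j : ℕ) + 1 = i then 3 else 2
  symm i j := by simp only [or_comm]
  two_le i j _ := by
    split_ifs
    · norm_num
    · exact le_rfl
  diag_ne_top i := by simp

/-- The alternating product `a b a ⋯` with exactly `m` factors. -/
def altProd {A : Type*} [Monoid A] (a b : A) : ℕ → A
  | 0 => 1
  | m + 1 => a * altProd b a m

/-- The defining relations of `NC(M)` in the free algebra on `T_i`, `i ∈ I`: the braid relation
with `m_{ij}` factors on either side for `i ≠ j` with `m_{ij} < ∞`, and `T_i ^ m_{ii} = 0`. -/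
inductive NCRel (k : Type*) [CommRing k] {I : Type*} [Finite I] (M : GenCoxeterMatrix I) :
    FreeAlgebra k I → FreeAlgebra k I → Prop
  | braid (i j : I) (m : ℕ) (hij : i ≠ j) (hm : M.entry i j = m) :
      NCRel k M (altProd (FreeAlgebra.ι k i) (FreeAlgebra.ι k j) m)
        (altProd (FreeAlgebra.ι k j) (FreeAlgebra.ι k i) m)
  | order (i : I) (m : ℕ) (hm : M.entry i i = m) :
      NCRel k M (FreeAlgebra.ι k i ^ m) 0

/-- The generalized nil-Coxeter algebra `NC(M)` over `k`. -/
abbrev NC (k : Type*) [CommRing k] {I : Type*} [Finite I] (M : GenCoxeterMatrix I) : Type _ :=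
  RingQuot (NCRel k M)

/-- The algebra `NC_A(n,d) = NC_{A_n}((2, …, 2, d))`. -/
abbrev NCA (k : Type*) [CommRing k] (n d : ℕ) : Type _ :=
  NC k ((GenCoxeterMatrix.typeA n).withDiag fun i : Fin n => if (i : ℕ) + 1 = n then d else 2)

/-- A `k`-algebra `A` over a field is Frobenius if it is finite-dimensional and carries a
nondegenerate bilinear form `σ` that is invariant: `σ(xy, z) = σ(x, yz)`. -/
def IsFrobeniusAlgebra (k A : Type*) [Field k] [Ring A] [Algebra k A] : Prop :=
  Module.Finite k A ∧
    ∃ σ : LinearMap.BilinForm k A,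
      σ.Nondegenerate ∧ ∀ x y z : A, σ (x * y) z = σ x (y * z)

/-! The obstruction is the space of elements `z` with `T_i z = 0` for all `i`. An invariant form
satisfies `σ (x * T_i) z = σ x (T_i * z) = 0` on them, so such a `z` is determined by `σ 1 z` and
the space is at most a line (`NCA.eq_zero_of_form_one_eq_zero`). For `n ≥ 2` and `d ≥ 3` it contains
two independent elements: the word of the longest permutation, and a maximal nonzero left extension
of `T_n ^ 2`. The quotient map to `NC_A(n,2)` kills the second but not the first.
Finite-dimensionality of `NC_A(n,d)` is never decided: it is part of being Frobenius, and is what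
makes a maximal extension exist.

Conversely, for `n = 1` the algebra is `k[T]/(T ^ d)`, with the coefficient of `T ^ (d - 1)` as
Frobenius functional. For `d = 2`, Matsumoto's theorem gives spanning words indexed by permutations,
and the functional is the coefficient of the longest one. It is constructed from an action on the
span of the permutations. In all of this, letters multiply on the left in the algebra and act on
places, from the right, on permutations. -/

/-- The defining relations of the braid group of type `A_n`, for a family in a monoid. -/
structure IsBraidFamily {M : Type*} [Monoid M] {n : ℕ} (t : Fin n → M) : Prop where
  braid : ∀ i j : Fin n, (i : ℕ) + 1 = j → t i * t j * t i = t j * t i * t j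
  comm : ∀ i j : Fin n, (i : ℕ) + 1 < j → t i * t j = t j * t i

/-! ### Adjacent transpositions and ascents of permutations -/

/-- The adjacent transposition exchanging the places `i` and `i + 1`. -/
def adjSwap {n : ℕ} (i : Fin n) : Equiv.Perm (Fin (n + 1)) := Equiv.swap i.castSucc i.succ

section adjSwap

variable {n : ℕ}

@[simp] lemma adjSwap_castSucc (i : Fin n) : adjSwap i i.castSucc = i.succ :=
  Equiv.swap_apply_left _ _

@[simp] lemma adjSwap_succ (i : Fin n) : adjSwap i i.succ = i.castSucc :=
  Equiv.swap_apply_right _ _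

lemma adjSwap_of_ne (i : Fin n) (x : Fin (n + 1)) (h : (x : ℕ) ≠ i) (h' : (x : ℕ) ≠ i + 1) :
    adjSwap i x = x :=
  Equiv.swap_apply_of_ne_of_ne (fun e => h (by simp [e])) (fun e => h' (by simp [e]))

@[simp] lemma adjSwap_mul_self (i : Fin n) : adjSwap i * adjSwap i = 1 :=
  Equiv.swap_mul_self _ _

@[simp] lemma mul_adjSwap_mul_adjSwap (w : Equiv.Perm (Fin (n + 1))) (i : Fin n) :
    w * adjSwap i * adjSwap i = w := by
  rw [mul_assoc, adjSwap_mul_self, mul_one]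

lemma adjSwap_comm (i j : Fin n) (h : (i : ℕ) + 1 < j) :
    adjSwap i * adjSwap j = adjSwap j * adjSwap i := by
  refine (Equiv.Perm.Disjoint.commute ?_).eq
  intro x
  by_cases h1 : (x : ℕ) = i ∨ (x : ℕ) = i + 1
  · exact Or.inr (adjSwap_of_ne _ _ (by omega) (by omega))
  · exact Or.inl (adjSwap_of_ne _ _ (by omega) (by omega))

lemma adjSwap_braid (i j : Fin n) (h : (i : ℕ) + 1 = j) :
    adjSwap i * adjSwap j * adjSwap i = adjSwap j * adjSwap i * adjSwap j := by
  have e : i.succ = j.castSucc := Fin.ext (by simpa using h)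
  have h1 : i.castSucc ≠ j.castSucc := fun e => by simp [Fin.ext_iff] at e; omega
  have h2 : i.castSucc ≠ j.succ := fun e => by simp [Fin.ext_iff] at e; omega
  have h3 : j.castSucc ≠ j.succ := fun e => by simp [Fin.ext_iff] at e
  unfold adjSwap
  rw [e, Equiv.swap_mul_swap_mul_swap h1 h2, Equiv.swap_comm i.castSucc j.castSucc,
    Equiv.swap_comm j.castSucc j.succ, Equiv.swap_mul_swap_mul_swap h3.symm h2.symm, Equiv.swap_comm]

/-- `w` is increasing at the places `i`, `i + 1`. -/
def AscentAt (w : Equiv.Perm (Fin (n + 1))) (i : Fin n) : Prop := w i.castSucc < w i.succ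

instance (w : Equiv.Perm (Fin (n + 1))) (i : Fin n) : Decidable (AscentAt w i) :=
  inferInstanceAs (Decidable (_ < _))

lemma ascentAt_mul_adjSwap {w : Equiv.Perm (Fin (n + 1))} {i : Fin n} :
    AscentAt (w * adjSwap i) i ↔ ¬ AscentAt w i := by
  have : w i.castSucc ≠ w i.succ := fun h => by
    have := w.injective h
    simp [Fin.ext_iff] at this
  simp only [AscentAt, Equiv.Perm.mul_apply, adjSwap_castSucc, adjSwap_succ, not_lt]
  exact ⟨le_of_lt, fun h => lt_of_le_of_ne h this.symm⟩

lemma ascentAt_mul_adjSwap_of_far {w : Equiv.Perm (Fin (n + 1))} {i j : Fin n}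
    (h : (i : ℕ) + 1 < j ∨ (j : ℕ) + 1 < i) :
    AscentAt (w * adjSwap i) j ↔ AscentAt w j := by
  simp only [AscentAt, Equiv.Perm.mul_apply]
  rw [adjSwap_of_ne, adjSwap_of_ne] <;> simp <;> omega

/-- For adjacent places, the ascent conditions along `i, j, i` read off the same three pairs
of entries as the ones along `j, i, j`. -/
lemma ascentAt_braid_iff (w : Equiv.Perm (Fin (n + 1))) {i j : Fin n} (h : (i : ℕ) + 1 = j) :
    (AscentAt (w * adjSwap i) j ↔ w i.castSucc < w j.succ) ∧
    (AscentAt (w * adjSwap j) i ↔ w i.castSucc < w j.succ) ∧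
    (AscentAt (w * adjSwap i * adjSwap j) i ↔ AscentAt w j) ∧
    (AscentAt (w * adjSwap j * adjSwap i) j ↔ AscentAt w i) := by
  have e : i.succ = j.castSucc := Fin.ext (by simpa using h)
  have a1 : adjSwap i j.castSucc = i.castSucc := by rw [← e, adjSwap_succ]
  have a3 : adjSwap i j.succ = j.succ := adjSwap_of_ne _ _ (by simp; omega) (by simp; omega)
  have a4 : adjSwap j i.castSucc = i.castSucc :=
    adjSwap_of_ne _ _ (by simp; omega) (by simp; omega)
  simp [AscentAt, a1, a3, a4, e]

/-- A permutation without descents is the identity. -/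
lemma eq_one_of_forall_ascentAt {w : Equiv.Perm (Fin (n + 1))} (h : ∀ i, AscentAt w i) :
    w = 1 := by
  have hm : StrictMono w := Fin.strictMono_iff_lt_succ.2 h
  ext x
  have := Subsingleton.elim (hm.orderIsoOfSurjective _ w.surjective) (OrderIso.refl _)
  have := congrArg (fun f => f x) this
  simpa using congrArg Fin.val this

/-- A permutation without ascents is the order reversal. -/
lemma eq_revPerm_of_forall_not_ascentAt {w : Equiv.Perm (Fin (n + 1))}
    (h : ∀ i, ¬ AscentAt w i) : w = Fin.revPerm := by
  have : Fin.revPerm * w = 1 := by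
    apply eq_one_of_forall_ascentAt
    intro i
    have h1 := ascentAt_mul_adjSwap.2 (h i)
    simpa [AscentAt, Equiv.Perm.mul_apply] using h1
  rw [← mul_one Fin.revPerm, ← this, ← mul_assoc]
  have : (Fin.revPerm * Fin.revPerm : Equiv.Perm (Fin (n + 1))) = 1 := by ext; simp
  rw [this, one_mul]

lemma not_ascentAt_revPerm (i : Fin n) : ¬ AscentAt (Fin.revPerm : Equiv.Perm (Fin (n + 1))) i := by
  simp [AscentAt, Fin.le_def]

/-- A statistic that drops whenever an ascent is turned into a descent. -/
def placeWeight (w : Equiv.Perm (Fin (n + 1))) : ℕ := ∑ x : Fin (n + 1), (x : ℕ) * (w x : ℕ)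

/-- Moving entries `a < b` from places `i`, `i + 1` to the opposite order changes the sum by `a -
b`. -/
lemma placeWeight_mul_adjSwap_lt {w : Equiv.Perm (Fin (n + 1))} {i : Fin n} (h : AscentAt w i) :
    placeWeight (w * adjSwap i) < placeWeight w := by
  have hne : i.castSucc ≠ i.succ := fun e => by simp [Fin.ext_iff] at e
  have key : ∀ v : Equiv.Perm (Fin (n + 1)), placeWeight v =
      (i : ℕ) * (v i.castSucc : ℕ) + ((i + 1 : ℕ) * (v i.succ : ℕ) +
        ∑ x ∈ (Finset.univ.erase i.castSucc).erase i.succ, (x : ℕ) * (v x : ℕ)) := by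
    intro v
    rw [placeWeight, ← Finset.add_sum_erase _ _ (Finset.mem_univ i.castSucc),
      ← Finset.add_sum_erase (Finset.univ.erase i.castSucc) _ (a := i.succ)
        (by simp [hne.symm])]
    simp
  have hs : ∑ x ∈ (Finset.univ.erase i.castSucc).erase i.succ, (x : ℕ) * ((w * adjSwap i) x : ℕ)
      = ∑ x ∈ (Finset.univ.erase i.castSucc).erase i.succ, (x : ℕ) * (w x : ℕ) := by
    refine Finset.sum_congr rfl fun x hx => ?_
    simp only [Finset.mem_erase, ne_eq, Fin.ext_iff, Fin.val_succ, Fin.val_castSucc] at hx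
    rw [Equiv.Perm.mul_apply, adjSwap_of_ne _ _ hx.2.1 hx.1]
  rw [key, key w, hs]
  have : (w i.castSucc : ℕ) < w i.succ := h
  simp only [Equiv.Perm.mul_apply, adjSwap_castSucc, adjSwap_succ]
  nlinarith

end adjSwap

/-! ### Reduced words and Matsumoto's theorem -/

/-- `IsReducedWord l w`: the word `l` creates `w` from the identity, each letter (read from the
right) turning an ascent into a descent. -/
inductive IsReducedWord {n : ℕ} : List (Fin n) → Equiv.Perm (Fin (n + 1)) → Prop
  | nil : IsReducedWord [] 1
  | cons (i : Fin n) (l : List (Fin n)) (w : Equiv.Perm (Fin (n + 1))) (h : AscentAt w i) :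
      IsReducedWord l w → IsReducedWord (i :: l) (w * adjSwap i)

section IsReducedWord

variable {n : ℕ}

lemma isReducedWord_cons_iff {i : Fin n} {l : List (Fin n)} {w : Equiv.Perm (Fin (n + 1))} :
    IsReducedWord (i :: l) w ↔ ¬ AscentAt w i ∧ IsReducedWord l (w * adjSwap i) := by
  constructor
  · intro h
    cases h with
    | cons _ _ v hv hl =>
      refine ⟨fun h' => ascentAt_mul_adjSwap.1 h' hv, ?_⟩
      simpa using hl
  · rintro ⟨h, hl⟩
    simpa using IsReducedWord.cons i l _ (ascentAt_mul_adjSwap.2 h) hl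

lemma isReducedWord_nil_iff {w : Equiv.Perm (Fin (n + 1))} : IsReducedWord [] w ↔ w = 1 :=
  ⟨fun h => by cases h; rfl, fun h => h ▸ .nil⟩

/-- Undoing a descent raises `placeWeight`, which is bounded, so the process ends at a permutation
without descents. -/
lemma exists_isReducedWord (w : Equiv.Perm (Fin (n + 1))) : ∃ l, IsReducedWord l w := by
  obtain ⟨b, hb⟩ := (Set.finite_range (placeWeight (n := n))).bddAbove
  have hb' : ∀ v : Equiv.Perm (Fin (n + 1)), placeWeight v ≤ b := fun v => hb ⟨v, rfl⟩
  induction hm : b - placeWeight w using Nat.strong_induction_on generalizing w with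
  | _ m ih =>
    by_cases h : ∀ i, AscentAt w i
    · exact ⟨[], isReducedWord_nil_iff.2 (eq_one_of_forall_ascentAt h)⟩
    · push Not at h
      obtain ⟨i, hi⟩ := h
      have h1 := placeWeight_mul_adjSwap_lt (ascentAt_mul_adjSwap.2 hi)
      rw [mul_adjSwap_mul_adjSwap] at h1
      have h2 := hb' (w * adjSwap i)
      obtain ⟨l, hl⟩ := ih _ (by omega) (w * adjSwap i) rfl
      exact ⟨i :: l, isReducedWord_cons_iff.2 ⟨hi, hl⟩⟩

variable {M : Type*} [Monoid M] {t : Fin n → M}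

/-- With descents at both `i` and `j`, one can strip off the whole longest element of the subgroup
generated by the two transpositions. A reduced word of what remains is a common tail, and the heads
differ by one commutation or braid relation. -/
lemma IsBraidFamily.exists_diamond_of_lt (ht : IsBraidFamily t) {w : Equiv.Perm (Fin (n + 1))}
    {i j : Fin n} (hij : i < j) (hi : ¬ AscentAt w i) (hj : ¬ AscentAt w j) :
    ∃ a b, IsReducedWord a (w * adjSwap i) ∧ IsReducedWord b (w * adjSwap j) ∧
      a.length = b.length ∧ t i * (a.map t).prod = t j * (b.map t).prod := by
  have hij' : (i : ℕ) < j := hij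
  rcases Nat.lt_or_ge ((i : ℕ) + 1) j with h | h
  · obtain ⟨l, hl⟩ := exists_isReducedWord (w * adjSwap i * adjSwap j)
    refine ⟨j :: l, i :: l, isReducedWord_cons_iff.2 ⟨?_, hl⟩, isReducedWord_cons_iff.2 ⟨?_, ?_⟩,
      rfl, ?_⟩
    · rwa [ascentAt_mul_adjSwap_of_far (Or.inl h)]
    · rwa [ascentAt_mul_adjSwap_of_far (Or.inr h)]
    · rwa [mul_assoc, ← adjSwap_comm i j h, ← mul_assoc]
    · simp only [List.map_cons, List.prod_cons, ← mul_assoc, ht.comm i j h]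
  · have h : (i : ℕ) + 1 = j := by omega
    have e : i.succ = j.castSucc := Fin.ext (by simpa using h)
    obtain ⟨l, hl⟩ := exists_isReducedWord (w * adjSwap i * adjSwap j * adjSwap i)
    obtain ⟨h1, h2, h3, h4⟩ := ascentAt_braid_iff w h
    have h5 : ¬ w i.castSucc < w j.succ := by
      simp only [AscentAt, not_lt] at hi hj ⊢
      rw [← e] at hj
      exact hj.trans hi
    refine ⟨j :: i :: l, i :: j :: l,
      isReducedWord_cons_iff.2 ⟨?_, isReducedWord_cons_iff.2 ⟨?_, hl⟩⟩,
      isReducedWord_cons_iff.2 ⟨?_, isReducedWord_cons_iff.2 ⟨?_, ?_⟩⟩, rfl, ?_⟩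
    · rwa [h1]
    · rwa [h3]
    · rwa [h2]
    · rwa [h4]
    · rw [mul_assoc, mul_assoc, ← mul_assoc (adjSwap j), ← adjSwap_braid i j h]
      simpa only [mul_assoc] using hl
    · simp only [List.map_cons, List.prod_cons, ← mul_assoc, ht.braid i j h]

lemma IsBraidFamily.exists_diamond (ht : IsBraidFamily t) {w : Equiv.Perm (Fin (n + 1))}
    {i j : Fin n} (hij : i ≠ j) (hi : ¬ AscentAt w i) (hj : ¬ AscentAt w j) :
    ∃ a b, IsReducedWord a (w * adjSwap i) ∧ IsReducedWord b (w * adjSwap j) ∧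
      a.length = b.length ∧ t i * (a.map t).prod = t j * (b.map t).prod := by
  rcases lt_or_gt_of_ne hij with h | h
  · exact ht.exists_diamond_of_lt h hi hj
  · obtain ⟨a, b, h1, h2, h3, h4⟩ := ht.exists_diamond_of_lt h hj hi
    exact ⟨b, a, h2, h1, h3.symm, h4.symm⟩

/-- Matsumoto's theorem in type `A`: the product of a braid family along a reduced word depends
only on the permutation. -/
lemma IsBraidFamily.prod_eq_of_isReducedWord (ht : IsBraidFamily t) {l l' : List (Fin n)}
    {w : Equiv.Perm (Fin (n + 1))} (hl : IsReducedWord l w) (hl' : IsReducedWord l' w) :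
    l.length = l'.length ∧ (l.map t).prod = (l'.map t).prod := by
  induction hm : l.length using Nat.strong_induction_on generalizing l l' w with
  | _ m ih =>
    subst hm
    cases l with
    | nil =>
      cases l' with
      | nil => exact ⟨rfl, rfl⟩
      | cons j m' =>
        rw [isReducedWord_nil_iff] at hl
        subst hl
        exact absurd (by simp [AscentAt, Fin.lt_def]) (isReducedWord_cons_iff.1 hl').1
    | cons i m =>
      cases l' with
      | nil =>
        rw [isReducedWord_nil_iff] at hl'
        subst hl'
        exact absurd (by simp [AscentAt, Fin.lt_def]) (isReducedWord_cons_iff.1 hl).1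
      | cons j m' =>
        obtain ⟨hi, hm⟩ := isReducedWord_cons_iff.1 hl
        obtain ⟨hj, hm'⟩ := isReducedWord_cons_iff.1 hl'
        by_cases hij : i = j
        · subst hij
          obtain ⟨h1, h2⟩ := ih m.length (by simp) hm hm' rfl
          exact ⟨by simp [h1], by simp [h2]⟩
        -- The words `i :: a` and `j :: b` interpolate: each comparison is then between words with
        -- the same first letter, hence between shorter words.
        · obtain ⟨a, b, ha, hb, hab, hp⟩ := ht.exists_diamond hij hi hj
          obtain ⟨h1, h2⟩ := ih m.length (by simp) hm ha rfl
          obtain ⟨h3, h4⟩ := ih b.length (by simp [← hab, ← h1]) hb hm' rfl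
          refine ⟨by simp [h1, hab, h3], ?_⟩
          simp only [List.map_cons, List.prod_cons]
          rw [h2, hp, h4]

end IsReducedWord

/-! ### Universal property and words of `NC_A(n,d)` -/

/-- A family in an algebra satisfying the defining relations of `NC_A(n,d)`. -/
structure IsNilCoxeterFamily {A : Type*} [MonoidWithZero A] {n : ℕ} (d : ℕ) (t : Fin n → A) : Prop
    extends IsBraidFamily t where
  sq : ∀ i : Fin n, (i : ℕ) + 1 ≠ n → t i ^ 2 = 0
  pow_last : ∀ i : Fin n, (i : ℕ) + 1 = n → t i ^ d = 0

lemma IsNilCoxeterFamily.sq_eq_zero {A : Type*} [MonoidWithZero A] {n : ℕ} {t : Fin n → A}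
    (h : IsNilCoxeterFamily 2 t) (i : Fin n) : t i ^ 2 = 0 :=
  if hi : (i : ℕ) + 1 = n then h.pow_last i hi else h.sq i hi

namespace NCA

variable {k : Type*} [Field k] {n d : ℕ}

variable (k d) in
/-- The generator `T_{i+1}` of `NC_A(n,d)`. -/
noncomputable def gen (i : Fin n) : NCA k n d := RingQuot.mkAlgHom k _ (FreeAlgebra.ι k i)

lemma isNilCoxeterFamily_gen : IsNilCoxeterFamily d (gen k d : Fin n → NCA k n d) where
  braid i j h := by
    have hij : i ≠ j := fun e => by simp [e] at h
    have := RingQuot.mkAlgHom_rel k (NCRel.braid (k := k)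
      (M := (GenCoxeterMatrix.typeA n).withDiag fun i : Fin n => if (i : ℕ) + 1 = n then d else 2)
      i j 3 hij (by simp [GenCoxeterMatrix.withDiag, GenCoxeterMatrix.typeA, hij, h]))
    simpa [altProd, mul_assoc, gen] using this
  comm i j h := by
    have hij : i ≠ j := fun e => by simp [e] at h
    have := RingQuot.mkAlgHom_rel k (NCRel.braid (k := k)
      (M := (GenCoxeterMatrix.typeA n).withDiag fun i : Fin n => if (i : ℕ) + 1 = n then d else 2)
      i j 2 hij (by
        have h1 : ¬ ((i : ℕ) + 1 = j ∨ (j : ℕ) + 1 = i) := by omega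
        simp [GenCoxeterMatrix.withDiag, GenCoxeterMatrix.typeA, hij, h1]))
    simpa [altProd, mul_assoc, gen] using this
  sq i h := by
    have := RingQuot.mkAlgHom_rel k (NCRel.order (k := k)
      (M := (GenCoxeterMatrix.typeA n).withDiag fun i : Fin n => if (i : ℕ) + 1 = n then d else 2)
      i 2 (by simp [GenCoxeterMatrix.withDiag, h]))
    simpa [gen] using this
  pow_last i h := by
    have := RingQuot.mkAlgHom_rel k (NCRel.order (k := k)
      (M := (GenCoxeterMatrix.typeA n).withDiag fun i : Fin n => if (i : ℕ) + 1 = n then d else 2)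
      i d (by simp [GenCoxeterMatrix.withDiag, h]))
    simpa [gen] using this

section lift

variable {A : Type*} [Semiring A] [Algebra k A] {t : Fin n → A}

lemma map_eq_of_rel (ht : IsNilCoxeterFamily d t) ⦃x y : FreeAlgebra k (Fin n)⦄
    (h : NCRel k ((GenCoxeterMatrix.typeA n).withDiag
      fun i : Fin n => if (i : ℕ) + 1 = n then d else 2) x y) :
    FreeAlgebra.lift k t x = FreeAlgebra.lift k t y := by
  cases h with
  | braid i j m hij hm =>
    simp only [GenCoxeterMatrix.withDiag, GenCoxeterMatrix.typeA, if_neg hij] at hm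
    split_ifs at hm with h
    · have hm : m = 3 := by exact_mod_cast hm.symm
      subst hm
      rcases h with h | h
      · simpa [altProd, mul_assoc] using ht.braid i j h
      · simpa [altProd, mul_assoc] using (ht.braid j i h).symm
    · have hm : m = 2 := by exact_mod_cast hm.symm
      subst hm
      have hij' : (i : ℕ) ≠ j := fun e => hij (Fin.ext e)
      rcases Nat.lt_or_gt_of_ne hij' with h' | h'
      · simpa [altProd] using ht.comm i j (by omega)
      · simpa [altProd] using (ht.comm j i (by omega)).symm
  | order i m hm =>
    simp only [GenCoxeterMatrix.withDiag, if_true] at hm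
    have hm : m = if (i : ℕ) + 1 = n then d else 2 := by exact_mod_cast hm.symm
    subst hm
    split_ifs with h
    · simpa using ht.pow_last i h
    · simpa using ht.sq i h

/-- The homomorphism given by a family satisfying the defining relations. -/
noncomputable def lift (ht : IsNilCoxeterFamily d t) : NCA k n d →ₐ[k] A :=
  RingQuot.liftAlgHom k ⟨FreeAlgebra.lift k t, map_eq_of_rel ht⟩

@[simp] lemma lift_gen (ht : IsNilCoxeterFamily d t) (i : Fin n) :
    lift (k := k) ht (gen k d i) = t i := by
  rw [lift, gen, RingQuot.liftAlgHom_mkAlgHom_apply, FreeAlgebra.lift_ι_apply]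

end lift

variable (k d) in
/-- The product of the generators along a word. -/
noncomputable def word (l : List (Fin n)) : NCA k n d := (l.map (gen k d)).prod

@[simp] lemma word_nil : word k d ([] : List (Fin n)) = 1 := rfl

@[simp] lemma word_cons (i : Fin n) (l : List (Fin n)) :
    word k d (i :: l) = gen k d i * word k d l := by
  simp [word]

@[simp] lemma word_append (l l' : List (Fin n)) :
    word k d (l ++ l') = word k d l * word k d l' := by
  simp [word]

lemma lift_word {A : Type*} [Semiring A] [Algebra k A] {t : Fin n → A} (ht : IsNilCoxeterFamily d t)
    (l : List (Fin n)) : lift (k := k) ht (word k d l) = (l.map t).prod := by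
  simp [word, map_list_prod, Function.comp_def]

/-- A subspace containing `1` and stable under left multiplication by the generators is
everything. -/
lemma eq_top_of_gen_mul_mem (S : Submodule k (NCA k n d)) (h1 : 1 ∈ S)
    (hS : ∀ i, ∀ x ∈ S, gen k d i * x ∈ S) : S = ⊤ := by
  have key : ∀ a : FreeAlgebra k (Fin n), ∀ x ∈ S, RingQuot.mkAlgHom k _ a * x ∈ S := by
    intro a
    induction a using FreeAlgebra.induction with
    | grade0 r =>
      intro x hx
      rw [AlgHom.commutes, ← Algebra.smul_def]
      exact S.smul_mem _ hx
    | grade1 i => exact hS i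
    | mul a b ha hb =>
      intro x hx
      rw [map_mul, mul_assoc]
      exact ha _ (hb _ hx)
    | add a b ha hb =>
      intro x hx
      rw [map_add, add_mul]
      exact S.add_mem (ha _ hx) (hb _ hx)
  refine eq_top_iff.2 fun x _ => ?_
  obtain ⟨a, rfl⟩ := RingQuot.mkAlgHom_surjective k _ x
  simpa using key a 1 h1

lemma span_range_word : Submodule.span k (Set.range (word k d : List (Fin n) → _)) = ⊤ := by
  refine eq_top_of_gen_mul_mem _ (Submodule.subset_span ⟨[], rfl⟩) fun i x hx => ?_
  induction hx using Submodule.span_induction with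
  | mem x hx =>
    obtain ⟨l, rfl⟩ := hx
    exact Submodule.subset_span ⟨i :: l, by simp⟩
  | zero => simp
  | add x y _ _ hx hy => rw [mul_add]; exact Submodule.add_mem _ hx hy
  | smul r x _ hx => rw [mul_smul_comm]; exact Submodule.smul_mem _ _ hx

end NCA

/-! ### A criterion for Frobenius algebras, and the case `n = 1` -/

/-- A functional for which a finite spanning family has a left dual family defines a Frobenius
form. -/
lemma isFrobeniusAlgebra_of_dual_family {k A ι : Type*} [Field k] [Ring A] [Algebra k A] [Finite ι]
    (b v : ι → A) (hb : Submodule.span k (Set.range b) = ⊤) (lam : A →ₗ[k] k)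
    (h1 : ∀ i, lam (v i * b i) = 1) (h0 : ∀ i j, j ≠ i → lam (v i * b j) = 0) :
    IsFrobeniusAlgebra k A := by
  have hfin : Module.Finite k A :=
    Module.finite_def.2 (hb ▸ Submodule.fg_span (Set.finite_range b))
  refine ⟨hfin, (LinearMap.mul k A).compr₂ lam, LinearMap.BilinForm.Nondegenerate.ofSeparatingRight ?_,
    fun x y z => by simp [mul_assoc]⟩
  intro x hx
  have := Fintype.ofFinite ι
  obtain ⟨c, rfl⟩ : ∃ c : ι → k, ∑ i, c i • b i = x := by
    rw [← Submodule.mem_span_range_iff_exists_fun, hb]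
    trivial
  refine Finset.sum_eq_zero fun i _ => ?_
  have h := hx (v i)
  simp only [LinearMap.compr₂_apply, LinearMap.mul_apply', map_sum, map_smul, smul_eq_mul] at h
  rw [Finset.sum_eq_single i (fun j _ hj => by rw [h0 i j hj, mul_zero]) (by simp), h1,
    mul_one] at h
  rw [h, zero_smul]

section truncShift

variable (k : Type*) [Field k]

/-- The backward shift on sequences supported in degrees `< d`. -/
def truncShift (d : ℕ) : Module.End k (ℕ → k) where
  toFun f m := if m + 1 < d then f (m + 1) else 0
  map_add' f g := by ext m; by_cases h : m + 1 < d <;> simp [h]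
  map_smul' c f := by ext m; by_cases h : m + 1 < d <;> simp [h]

variable {k}

/-- The exponent `0` is excluded because the identity does not truncate: the space consists of all
sequences. -/
lemma truncShift_pow_apply {d : ℕ} {j : ℕ} (hj : 1 ≤ j) (f : ℕ → k) (m : ℕ) :
    (truncShift k d ^ j) f m = if m + j < d then f (m + j) else 0 := by
  induction j, hj using Nat.le_induction generalizing m with
  | base => simp [truncShift]
  | succ j hj ih =>
    rw [pow_succ', Module.End.mul_apply]
    change (if m + 1 < d then (truncShift k d ^ j) f (m + 1) else 0) = _
    rw [ih, show m + 1 + j = m + (j + 1) by ring]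
    split_ifs <;> first | rfl | omega

lemma truncShift_pow_self {d : ℕ} (hd : 1 ≤ d) : truncShift k d ^ d = 0 := by
  ext f m
  rw [truncShift_pow_apply hd]
  simp

/-- All generators but the last act by zero, the last one by a nilpotent shift. -/
lemma isNilCoxeterFamily_truncShift {n d : ℕ} (hd : 1 ≤ d) :
    IsNilCoxeterFamily d
      fun i : Fin n => if (i : ℕ) + 1 = n then truncShift k d else 0 where
  braid i j h := by
    have : (i : ℕ) + 1 ≠ n := by omega
    simp [this]
  comm i j h := by
    have : (i : ℕ) + 1 ≠ n := by omega
    simp [this]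
  sq i h := by simp [h]
  pow_last i h := by simp [h, truncShift_pow_self hd]

end truncShift

lemma isFrobeniusAlgebra_NCA_one (k : Type*) [Field k] {d : ℕ} (hd : 2 ≤ d) :
    IsFrobeniusAlgebra k (NCA k 1 d) := by
  have hfam := isNilCoxeterFamily_truncShift (k := k) (n := 1) (d := d) (by omega)
  let T : NCA k 1 d := NCA.gen k d 0
  have hT : T ^ d = 0 := NCA.isNilCoxeterFamily_gen.pow_last 0 (by simp)
  -- Apply an element to the top basis vector and read degree `0`: this extracts the coefficient of
  -- `T ^ (d - 1)`.
  let lam : NCA k 1 d →ₗ[k] k := (LinearMap.proj 0).comp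
    ((LinearMap.applyₗ (Pi.single (d - 1) 1 : ℕ → k)).comp (NCA.lift (k := k) hfam).toLinearMap)
  have hlam : ∀ j, lam (T ^ j) = if j = d - 1 then 1 else 0 := by
    intro j
    have h : lam (T ^ j) = (truncShift k d ^ j) (Pi.single (d - 1) 1) 0 := by
      simp [lam, T, -LinearMap.pi_apply]
    rw [h]
    rcases Nat.eq_zero_or_pos j with rfl | hj
    · have : 0 ≠ d - 1 := by omega
      simp [this]
    · rw [truncShift_pow_apply hj, zero_add, Pi.single_apply]
      split_ifs <;> first | rfl | omega
  refine isFrobeniusAlgebra_of_dual_family (ι := Fin d) (fun i => T ^ (i : ℕ))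
    (fun i => T ^ (d - 1 - i)) ?_ lam ?_ ?_
  · refine NCA.eq_top_of_gen_mul_mem _ (Submodule.subset_span ⟨⟨0, by omega⟩, by simp⟩)
      fun i x hx => ?_
    rw [Subsingleton.elim i 0]
    induction hx using Submodule.span_induction with
    | mem x hx =>
      obtain ⟨j, rfl⟩ := hx
      change T * T ^ (j : ℕ) ∈ _
      rw [← pow_succ']
      by_cases hj : (j : ℕ) + 1 < d
      · exact Submodule.subset_span ⟨⟨_, hj⟩, rfl⟩
      · rw [show (j : ℕ) + 1 = d by omega, hT]
        exact Submodule.zero_mem _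
    | zero => simp
    | add x y _ _ hx hy => rw [mul_add]; exact Submodule.add_mem _ hx hy
    | smul r x _ hx => rw [mul_smul_comm]; exact Submodule.smul_mem _ _ hx
  · intro i
    rw [← pow_add, hlam, if_pos (by omega)]
  · intro i j hij
    have : (j : ℕ) ≠ i := fun e => hij (Fin.ext e)
    rw [← pow_add, hlam, if_neg (by omega)]

/-! ### The sorting action and the case `d = 2` -/

section sortOp

variable (k : Type*) [Field k] {n : ℕ}

/-- The operator on the span of the permutations that turns an ascent at `i` into a descent and
kills the permutations with a descent at `i`. -/
noncomputable def sortOp (i : Fin n) : Module.End k (Equiv.Perm (Fin (n + 1)) →₀ k) :=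
  Finsupp.linearCombination k fun w =>
    if AscentAt w i then Finsupp.single (w * adjSwap i) 1 else 0

variable {k}

lemma sortOp_single (i : Fin n) (w : Equiv.Perm (Fin (n + 1))) :
    sortOp k i (Finsupp.single w 1) =
      if AscentAt w i then Finsupp.single (w * adjSwap i) 1 else 0 := by
  simp [sortOp]

lemma sortOp_single_of_ascentAt {i : Fin n} {w : Equiv.Perm (Fin (n + 1))} (h : AscentAt w i) :
    sortOp k i (Finsupp.single w 1) = Finsupp.single (w * adjSwap i) 1 := by
  rw [sortOp_single, if_pos h]

lemma sortOp_single_of_not_ascentAt {i : Fin n} {w : Equiv.Perm (Fin (n + 1))}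
    (h : ¬ AscentAt w i) : sortOp k i (Finsupp.single w 1) = 0 := by
  rw [sortOp_single, if_neg h]

lemma sortOp_sq (i : Fin n) : sortOp k i ^ 2 = 0 := by
  refine Finsupp.basisSingleOne.ext fun w => ?_
  rw [Finsupp.coe_basisSingleOne, pow_two, Module.End.mul_apply, LinearMap.zero_apply]
  by_cases h : AscentAt w i
  · rw [sortOp_single_of_ascentAt h, sortOp_single_of_not_ascentAt]
    exact fun h' => ascentAt_mul_adjSwap.1 h' h
  · rw [sortOp_single_of_not_ascentAt h, map_zero]

lemma sortOp_comm (i j : Fin n) (h : (i : ℕ) + 1 < j) :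
    sortOp k i * sortOp k j = sortOp k j * sortOp k i := by
  refine Finsupp.basisSingleOne.ext fun w => ?_
  rw [Finsupp.coe_basisSingleOne, Module.End.mul_apply, Module.End.mul_apply]
  by_cases hi : AscentAt w i <;> by_cases hj : AscentAt w j <;>
    simp [sortOp_single, hi, hj, ascentAt_mul_adjSwap_of_far (Or.inl h),
      ascentAt_mul_adjSwap_of_far (Or.inr h), mul_assoc, adjSwap_comm i j h]

/-- Both sides are nonzero on `w` exactly when its three entries at the places involved increase;
both then reverse them. -/
lemma sortOp_braid (i j : Fin n) (h : (i : ℕ) + 1 = j) :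
    sortOp k i * sortOp k j * sortOp k i = sortOp k j * sortOp k i * sortOp k j := by
  refine Finsupp.basisSingleOne.ext fun w => ?_
  rw [Finsupp.coe_basisSingleOne]
  simp only [Module.End.mul_apply]
  obtain ⟨h1, h2, h3, h4⟩ := ascentAt_braid_iff w h
  have hb : w * adjSwap i * adjSwap j * adjSwap i = w * adjSwap j * adjSwap i * adjSwap j := by
    simpa only [mul_assoc] using congrArg (w * ·) (adjSwap_braid i j h)
  by_cases hi : AscentAt w i <;> by_cases hj : AscentAt w j <;>
    by_cases hij : w i.castSucc < w j.succ <;>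
    simp [sortOp_single, hi, hj, h1, h2, h3, h4, hij, hb]

lemma isNilCoxeterFamily_sortOp : IsNilCoxeterFamily 2 (sortOp k : Fin n → _) where
  braid := sortOp_braid
  comm := sortOp_comm
  sq i _ := sortOp_sq i
  pow_last i _ := sortOp_sq i

lemma prod_sortOp_of_isReducedWord {l : List (Fin n)} {w : Equiv.Perm (Fin (n + 1))}
    (h : IsReducedWord l w) :
    (l.map (sortOp k)).prod (Finsupp.single 1 1) = Finsupp.single w 1 := by
  induction h with
  | nil => simp
  | cons i l w hw _ ih =>
    rw [List.map_cons, List.prod_cons, Module.End.mul_apply, ih, sortOp_single_of_ascentAt hw]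

/-- Every permutation can be sorted to the order reversal by a word which sorts no other
permutation to it. -/
lemma exists_prod_sortOp_eq_revPerm (w : Equiv.Perm (Fin (n + 1))) :
    ∃ l : List (Fin n),
      (l.map (sortOp k)).prod (Finsupp.single w 1) = Finsupp.single Fin.revPerm 1 ∧
      ∀ w' ≠ w, (l.map (sortOp k)).prod (Finsupp.single w' 1) Fin.revPerm = 0 := by
  induction hm : placeWeight w using Nat.strong_induction_on generalizing w with
  | _ m ih =>
    by_cases h : ∃ i, AscentAt w i
    · obtain ⟨i, hi⟩ := h
      obtain ⟨l, hl, hl'⟩ := ih _ (hm ▸ placeWeight_mul_adjSwap_lt hi) (w * adjSwap i) rfl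
      refine ⟨l ++ [i], ?_, fun w' hw' => ?_⟩
      · simp [sortOp_single_of_ascentAt hi, hl]
      · by_cases hi' : AscentAt w' i
        · simpa [sortOp_single_of_ascentAt hi'] using
            hl' (w' * adjSwap i) fun e => hw' (mul_right_cancel e)
        · simp [sortOp_single_of_not_ascentAt hi']
    · push Not at h
      obtain rfl := eq_revPerm_of_forall_not_ascentAt h
      exact ⟨[], by simp, fun w' hw' => by simp [hw']⟩

end sortOp

namespace NCA

variable {k : Type*} [Field k] {n d : ℕ}

variable (k n) in
/-- The action of the nil-Coxeter algebra on the span of the permutations. -/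
noncomputable def sortHom :
    NCA k n 2 →ₐ[k] Module.End k (Equiv.Perm (Fin (n + 1)) →₀ k) :=
  lift isNilCoxeterFamily_sortOp

lemma sortHom_word (l : List (Fin n)) :
    sortHom k n (word k 2 l) = (l.map (sortOp k)).prod := lift_word _ l

lemma word_eq_of_isReducedWord {l l' : List (Fin n)} {w : Equiv.Perm (Fin (n + 1))}
    (h : IsReducedWord l w) (h' : IsReducedWord l' w) : word k d l = word k d l' :=
  (isNilCoxeterFamily_gen.toIsBraidFamily.prod_eq_of_isReducedWord h h').2

/-- If `w` has a descent at `i`, a generator of square zero at `i` kills its reduced words. -/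
lemma gen_mul_word_of_not_ascentAt {i : Fin n} (hi : gen k d i ^ 2 = 0) {l : List (Fin n)}
    {w : Equiv.Perm (Fin (n + 1))} (h : IsReducedWord l w) (hw : ¬ AscentAt w i) :
    gen k d i * word k d l = 0 := by
  obtain ⟨l', hl'⟩ := exists_isReducedWord (w * adjSwap i)
  rw [word_eq_of_isReducedWord h (isReducedWord_cons_iff.2 ⟨hw, hl'⟩), word_cons, ← mul_assoc,
    ← pow_two, hi, zero_mul]

/-- The nil-Coxeter algebra of type `A_n` is Frobenius. -/
lemma isFrobeniusAlgebra_two (k : Type*) [Field k] (n : ℕ) : IsFrobeniusAlgebra k (NCA k n 2) := by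
  choose b hb using exists_isReducedWord (n := n)
  choose v hv hv' using exists_prod_sortOp_eq_revPerm (k := k) (n := n)
  -- The coefficient of the order reversal after acting on the identity permutation.
  let lam : NCA k n 2 →ₗ[k] k := (Finsupp.lapply Fin.revPerm).comp
    ((LinearMap.applyₗ (Finsupp.single 1 1 : Equiv.Perm (Fin (n + 1)) →₀ k)).comp
      (sortHom k n).toLinearMap)
  have hlam : ∀ l w, lam (word k 2 l * word k 2 (b w)) =
      (l.map (sortOp k)).prod (Finsupp.single w 1) Fin.revPerm := by
    intro l w
    simp only [lam, LinearMap.comp_apply, AlgHom.toLinearMap_apply, map_mul, sortHom_word,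
      LinearMap.applyₗ_apply_apply, Module.End.mul_apply, prod_sortOp_of_isReducedWord (hb w),
      Finsupp.lapply_apply]
  refine isFrobeniusAlgebra_of_dual_family (fun w => word k 2 (b w)) (fun w => word k 2 (v w)) ?_
    lam (fun w => ?_) fun w w' hw => ?_
  -- Only the length statement of Matsumoto's theorem is needed, so any braid family serves.
  · have h1 : b 1 = [] := by
      simpa using (IsBraidFamily.prod_eq_of_isReducedWord (t := sortOp ℚ)
        isNilCoxeterFamily_sortOp.toIsBraidFamily (hb 1) .nil).1
    refine eq_top_of_gen_mul_mem _ (Submodule.subset_span ⟨1, by simp [h1]⟩) fun i x hx => ?_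
    induction hx using Submodule.span_induction with
    | mem x hx =>
      obtain ⟨w, rfl⟩ := hx
      by_cases hw : AscentAt w i
      · refine Submodule.subset_span ⟨w * adjSwap i, ?_⟩
        change _ = gen k 2 i * word k 2 (b w)
        rw [← word_cons]
        exact word_eq_of_isReducedWord (hb _) (.cons i _ w hw (hb w))
      · have := gen_mul_word_of_not_ascentAt (k := k) (d := 2)
          (isNilCoxeterFamily_gen.sq_eq_zero i) (hb w) hw
        simp [this]
    | zero => simp
    | add x y _ _ hx hy => rw [mul_add]; exact Submodule.add_mem _ hx hy
    | smul r x _ hx => rw [mul_smul_comm]; exact Submodule.smul_mem _ _ hx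
  · rw [hlam, hv, Finsupp.single_eq_same]
  · rw [hlam, hv' w w' hw]

/-! ### Failure for `n ≥ 2` and `d ≥ 3` -/

/-- For `n ≥ 2`, the reduced words of the longest permutation are killed by every generator. -/
lemma gen_mul_word_revPerm (hn : 2 ≤ n) {l : List (Fin n)} (hl : IsReducedWord l Fin.revPerm)
    (i : Fin n) : gen k d i * word k d l = 0 := by
  by_cases hi : (i : ℕ) + 1 = n
  -- The last generator need not square to zero, but its neighbour does: a reduced word beginning `j
  -- i j` gives `T_i T_j T_i T_j = T_j T_i T_j T_j = 0`.
  · let j : Fin n := ⟨i - 1, by omega⟩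
    have hj : (j : ℕ) + 1 = i := by simp only [j]; omega
    have hjn : (j : ℕ) + 1 ≠ n := by omega
    obtain ⟨l', hl'⟩ := exists_isReducedWord (Fin.revPerm * adjSwap j * adjSwap i * adjSwap j)
    obtain ⟨h1, -, h3, -⟩ := ascentAt_braid_iff Fin.revPerm hj
    have hr : IsReducedWord (j :: i :: j :: l') Fin.revPerm := by
      simp only [isReducedWord_cons_iff]
      refine ⟨not_ascentAt_revPerm j, ?_, ?_, hl'⟩
      · rw [h1]
        simp [Fin.lt_def]
        omega
      · rw [h3]
        exact not_ascentAt_revPerm i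
    have hb := (isNilCoxeterFamily_gen (k := k) (d := d)).braid j i hj
    have hs := (isNilCoxeterFamily_gen (k := k) (d := d)).sq j hjn
    rw [word_eq_of_isReducedWord hl hr]
    simp only [word_cons, ← mul_assoc]
    rw [← hb, mul_assoc _ (gen k d j) (gen k d j), ← pow_two, hs, mul_zero, zero_mul]
  · exact gen_mul_word_of_not_ascentAt (isNilCoxeterFamily_gen.sq i hi) hl (not_ascentAt_revPerm i)

/-- The nil-Coxeter algebra of type `A_n` is a quotient of `NC_A(n,d)`. -/
lemma isNilCoxeterFamily_gen_two (hd : 2 ≤ d) :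
    IsNilCoxeterFamily d (gen k 2 : Fin n → NCA k n 2) where
  toIsBraidFamily := isNilCoxeterFamily_gen.toIsBraidFamily
  sq := isNilCoxeterFamily_gen.sq
  pow_last i h := pow_eq_zero_of_le hd (isNilCoxeterFamily_gen.pow_last i h)

lemma word_two_ne_zero {l : List (Fin n)} {w : Equiv.Perm (Fin (n + 1))} (h : IsReducedWord l w) :
    word k 2 l ≠ 0 := by
  intro h0
  have h1 := prod_sortOp_of_isReducedWord (k := k) h
  rw [← sortHom_word, h0, map_zero] at h1
  simpa using DFunLike.congr_fun h1 w

open Polynomial in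
/-- The relations of `NC_A(n,d)` are homogeneous in the number of letters. -/
lemma isNilCoxeterFamily_C_gen_mul_X :
    IsNilCoxeterFamily d fun i : Fin n => (C (gen k d i) * X : (NCA k n d)[X]) := by
  have hmul : ∀ (a b : NCA k n d) (p q : ℕ),
      (C a * X ^ p : (NCA k n d)[X]) * (C b * X ^ q) = C (a * b) * X ^ (p + q) := by
    intro a b p q
    rw [C_mul_X_pow_eq_monomial, C_mul_X_pow_eq_monomial, C_mul_X_pow_eq_monomial,
      monomial_mul_monomial]
  have hpow : ∀ (a : NCA k n d) (m : ℕ), (C a * X : (NCA k n d)[X]) ^ m = C (a ^ m) * X ^ m := by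
    intro a m
    rw [(commute_X (C a)).symm.mul_pow, C_pow]
  have h := isNilCoxeterFamily_gen (k := k) (n := n) (d := d)
  refine ⟨⟨fun i j hij => ?_, fun i j hij => ?_⟩, fun i hi => ?_, fun i hi => ?_⟩
  · rw [← pow_one X]
    simp only [hmul, h.braid i j hij]
  · rw [← pow_one X]
    simp only [hmul, h.comm i j hij]
  · rw [hpow, h.sq i hi, C_0, zero_mul]
  · rw [hpow, h.pow_last i hi, C_0, zero_mul]

variable (k n d) in
open Polynomial in
/-- The grading by the number of letters, as a homomorphism to polynomials. -/
noncomputable def gradeHom : NCA k n d →ₐ[k] (NCA k n d)[X] :=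
  lift isNilCoxeterFamily_C_gen_mul_X

open Polynomial in
lemma gradeHom_gen (i : Fin n) : gradeHom k n d (gen k d i) = C (gen k d i) * X := lift_gen _ i

open Polynomial in
lemma gradeHom_word (l : List (Fin n)) :
    gradeHom k n d (word k d l) = C (word k d l) * X ^ l.length := by
  induction l with
  | nil => simp
  | cons i l ih =>
    rw [word_cons, map_mul, ih, gradeHom_gen, C_mul, List.length_cons, pow_succ']
    simp only [mul_assoc]
    rw [← mul_assoc X, (commute_X (C (word k d l))).eq, mul_assoc]

open Polynomial in
/-- In finite dimension, the nonzero words have bounded length. -/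
lemma bddAbove_length_of_word_ne_zero [Module.Finite k (NCA k n d)] :
    BddAbove {m | ∃ l : List (Fin n), l.length = m ∧ word k d l ≠ 0} := by
  set S := {m | ∃ l : List (Fin n), l.length = m ∧ word k d l ≠ 0}
  -- One nonzero word per attained length: these lie in distinct degrees, hence are independent.
  choose f hf hf' using fun m : S => m.2
  have hli : LinearIndependent k fun m : S => word k d (f m) := by
    rw [linearIndependent_iff']
    intro s g hg m hm
    have h1 := congrArg (fun x => (gradeHom k n d x).coeff m) hg
    simp only [map_sum, map_smul, gradeHom_word, finsetSum_coeff, coeff_smul, hf,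
      coeff_C_mul_X_pow, map_zero, coeff_zero] at h1
    rw [Finset.sum_eq_single m (fun b _ hb => by
      rw [if_neg fun e => hb (Subtype.ext e.symm), smul_zero]) (fun h => absurd hm h),
      if_pos rfl] at h1
    exact (smul_eq_zero.1 h1).resolve_right (hf' m)
  have : Finite S := hli.finite
  exact (Set.toFinite S).bddAbove

/-- In finite dimension, every word which is nonzero extends on the left to a nonzero word
killed by all generators. -/
lemma exists_word_gen_mul_eq_zero [Module.Finite k (NCA k n d)] {l : List (Fin n)}
    (hl : word k d l ≠ 0) :
    ∃ l', word k d (l' ++ l) ≠ 0 ∧ ∀ i, gen k d i * word k d (l' ++ l) = 0 := by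
  obtain ⟨b, hb⟩ := bddAbove_length_of_word_ne_zero (k := k) (n := n) (d := d)
  by_contra! hcon
  have : ∀ m, ∃ l' : List (Fin n), l'.length = m ∧ word k d (l' ++ l) ≠ 0 := by
    intro m
    induction m with
    | zero => exact ⟨[], rfl, hl⟩
    | succ m ih =>
      obtain ⟨l', h1, h2⟩ := ih
      obtain ⟨i, hi⟩ := hcon l' h2
      exact ⟨i :: l', by simp [h1], by simpa using hi⟩
  obtain ⟨l', h1, h2⟩ := this (b + 1)
  have := hb ⟨l' ++ l, rfl, h2⟩
  simp at this
  omega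

/-- The squared shift of the constant sequence `1` has entry `1` in degree `0`, since `2 < d`. -/
lemma gen_last_sq_ne_zero (hd : 3 ≤ d) {i : Fin n} (hi : (i : ℕ) + 1 = n) :
    gen k d i ^ 2 ≠ 0 := by
  intro h
  have h1 := congrArg (lift (k := k) (isNilCoxeterFamily_truncShift (k := k) (by omega))) h
  rw [map_pow, lift_gen, if_pos hi, map_zero] at h1
  have h2 := congrFun (DFunLike.congr_fun h1 (fun _ => (1 : k))) 0
  rw [truncShift_pow_apply (by omega), if_pos (by omega)] at h2
  exact one_ne_zero h2

/-- An element killed by all generators from the left is detected by its pairing with `1`. -/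
lemma eq_zero_of_form_one_eq_zero {σ : LinearMap.BilinForm k (NCA k n d)} (hσ : σ.Nondegenerate)
    (hinv : ∀ x y z, σ (x * y) z = σ x (y * z)) {z : NCA k n d}
    (hz : ∀ i, gen k d i * z = 0) (hz1 : σ 1 z = 0) : z = 0 := by
  refine hσ.2 z fun a => ?_
  have hker : LinearMap.ker (σ.flip z) = ⊤ := by
    rw [eq_top_iff, ← span_range_word, Submodule.span_le]
    rintro _ ⟨l, rfl⟩
    rcases List.eq_nil_or_concat l with rfl | ⟨l', i, rfl⟩
    · simpa using hz1
    · simp [hinv, hz]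
  have : a ∈ LinearMap.ker (σ.flip z) := hker ▸ trivial
  simpa using this

lemma not_isFrobeniusAlgebra (hn : 2 ≤ n) (hd : 3 ≤ d) : ¬ IsFrobeniusAlgebra k (NCA k n d) := by
  rintro ⟨hfin, σ, hσ, hinv⟩
  let p : Fin n := ⟨n - 1, by omega⟩
  have hp : (p : ℕ) + 1 = n := by simp only [p]; omega
  obtain ⟨l, hl⟩ := exists_isReducedWord (Fin.revPerm : Equiv.Perm (Fin (n + 1)))
  obtain ⟨l', hy0, hy⟩ := exists_word_gen_mul_eq_zero (k := k) (d := d) (l := [p, p])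
    (by simpa [pow_two] using gen_last_sq_ne_zero (k := k) hd hp)
  have hx := gen_mul_word_revPerm (k := k) (d := d) hn hl
  set y := word k d (l' ++ [p, p])
  -- This combination is killed by all generators and pairs to zero with `1`.
  have h : σ 1 (word k d l) • y - σ 1 y • word k d l = 0 :=
    eq_zero_of_form_one_eq_zero hσ hinv (fun i => by simp [mul_sub, hx, hy]) (by simp [mul_comm])
  let π := lift (k := k) (isNilCoxeterFamily_gen_two (k := k) (n := n) (d := d) (by omega))
  have hπ : ∀ l : List (Fin n), π (word k d l) = word k 2 l := fun l => lift_word _ l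
  have h' := congrArg π (sub_eq_zero.1 h)
  have hpp : word k 2 (l' ++ [p, p]) = 0 := by
    have := isNilCoxeterFamily_gen (k := k) (d := 2) |>.sq_eq_zero p
    simp [← pow_two, this]
  -- In `NC_A(n,2)` only the term of the longest word survives, which forces `σ 1 y = 0` and hence
  -- `y = 0`.
  rw [map_smul, map_smul, hπ, hπ, hpp, smul_zero, eq_comm, smul_eq_zero] at h'
  have hy1 := h'.resolve_right (word_two_ne_zero hl)
  exact hy0 (eq_zero_of_form_one_eq_zero hσ hinv hy hy1)

end NCA

theorem mainTheorem4 (k : Type*) [Field k] (n d : ℕ) (hn : 1 ≤ n) (hd : 2 ≤ d) :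
    IsFrobeniusAlgebra k (NCA k n d) ↔ n = 1 ∨ d = 2 := by
  constructor
  · intro h
    by_contra! hcon
    exact NCA.not_isFrobeniusAlgebra (by omega) (by omega) h
  · rintro (rfl | rfl)
    · exact isFrobeniusAlgebra_NCA_one k hd
    · exact NCA.isFrobeniusAlgebra_two k n
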